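/- Let $p$ be a prime. For $n\ge 1$ let $P_n$ be a Sylow $p$-subgroup of the symmetric group $S_{p^n}$. Choose a conjugacy class $C$ of $P_n$ uniformly at random among all conjugacy classes of $P_n$, let $o(C)$ be the common order of the elements of $C$, and put $\xi_n=\log_p o(C)$. Then, as $n$ varies over the positive integers with $p$ fixed, $\xi_n$ has mean value $$\mathbf{E}\,\xi_n=\frac{\log n}{\log p}+O(1)$$ and bounded variance; the implied constant and the bound depend only on $p$. Consequently almost all conjugacy classes have order $p^{(1+o(1))\log_p n}$: for every $\varepsilon>0$, $$\mathbf{P}\bigl(|\xi_n-\log_p n|>\varepsilon\log_p n\bigr)\to 0\qquad (n\to\infty).$$ -/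

import Mathlib

open MeasureTheory ProbabilityTheory

/-- Conjugate elements of a group have the same order. -/
theorem orderOf_eq_of_isConj {G : Type*} [Group G] {a b : G} (h : IsConj a b) :
    orderOf a = orderOf b := by
  obtain ⟨c, rfl⟩ := isConj_iff.1 h
  exact (orderOf_injective (MulAut.conj c).toMonoidHom (MulAut.conj c).injective a).symm

/-- The order `o(C)` of a conjugacy class: the common order of its elements. -/
noncomputable def classOrder {G : Type*} [Group G] (C : ConjClasses G) : ℕ :=
  Quotient.liftOn C orderOf fun _ _ h => orderOf_eq_of_isConj h

/-- Every set of conjugacy classes is an event. -/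
instance conjClassesMeasurableSpace (G : Type*) [Group G] : MeasurableSpace (ConjClasses G) := ⊤

open Classical in
/-- The uniform distribution on the set of conjugacy classes of a finite group: each class has the
same probability, whatever its size. -/
noncomputable def uniformClass (G : Type*) [Group G] [Finite G] : Measure (ConjClasses G) :=
  letI : Fintype (ConjClasses G) := Fintype.ofFinite _
  (PMF.uniformOfFintype (ConjClasses G)).toMeasure

/-- The random variable `ξ = log_p o(C)`, as a function on the conjugacy classes. -/
noncomputable def logOrder (p : ℕ) {G : Type*} [Group G] (C : ConjClasses G) : ℝ :=
  Real.logb p (classOrder C)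

/-! A Sylow `p`-subgroup of the symmetric group of degree `p ^ n` is an iterated wreath product, so
everything rests on one step `G ≀ᵣ Q` with `Q` of order `p`. A class inside the base group is a
`Q`-orbit of functions `Q → ConjClasses G`, and its order is the largest order among its
coordinates. Over each `c ≠ 1` the classes correspond to the classes `D` of `G`, and their orders
are divisible by `p * classOrder D`. Hence the class numbers k_n satisfy p k_{n+1} = k_n^p + (p² -
1) k_n (`card_conjClasses`). They grow doubly exponentially, so twisted classes, the only ones that
raise the order, soon become rare.

Upper bound: for a suitable θ > 1 the mean of θ^o is at most multiplied by p at each step, up to a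
bounded additive term (`sum_pow_classOrder_succ_le`). So it is O(p^n), and convexity gives E o =
O(n).

Lower bound: the number of classes of order dividing p^m satisfies the same recursion as k_n, as an
inequality. Above level m the odds of such an order therefore decay geometrically (`odds_step`).
Against the initial odds, at most k_{m+1} ≤ p^(p^(m+1)), this leaves probability O(1/n) for orders
below a small multiple of n, whence E(1/o) = O(1/n).

Since (log x)² ≤ 2(x + 1/x) with x = o/n, log o has bounded second moment about log n. The mean, the
variance and the concentration all follow from this. -/

namespace RegularWreathProduct

/-! ### Powers and conjugacy in a regular wreath product -/

variable {G Q : Type*} [Group G] [CommGroup Q]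

theorem pow_right (w : G ≀ᵣ Q) (n : ℕ) : (w ^ n).right = w.right ^ n :=
  map_pow (rightHom : G ≀ᵣ Q →* Q) w n

theorem pow_succ_left (w : G ≀ᵣ Q) (n : ℕ) (x : Q) :
    (w ^ (n + 1)).left x = (w ^ n).left x * w.left ((w.right ^ n)⁻¹ * x) := by
  rw [pow_succ, mul_left, Pi.mul_apply, pow_right]

theorem mk_one_pow (f : Q → G) (n : ℕ) : (⟨f, 1⟩ : G ≀ᵣ Q) ^ n = ⟨f ^ n, 1⟩ := by
  induction n with
  | zero => rw [pow_zero, pow_zero]; rfl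
  | succ n ih => rw [pow_succ, ih, pow_succ f]; ext x <;> simp

theorem conj_left_of_right_eq_one (v w : G ≀ᵣ Q) (hw : w.right = 1) (x : Q) :
    (v * w * v⁻¹).left x = v.left x * w.left (v.right⁻¹ * x) * (v.left x)⁻¹ := by
  simp [hw]

theorem right_eq_of_isConj {v w : G ≀ᵣ Q} (h : IsConj v w) : v.right = w.right := by
  obtain ⟨c, rfl⟩ := isConj_iff.1 h
  simp

theorem isConj_mk_one_iff {f g : Q → G} :
    IsConj (⟨f, 1⟩ : G ≀ᵣ Q) ⟨g, 1⟩ ↔ ∃ d : Q, ∀ x, IsConj (f (d⁻¹ * x)) (g x) := by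
  constructor
  · intro h
    obtain ⟨c, hc⟩ := isConj_iff.1 h
    refine ⟨c.right, fun x => isConj_iff.2 ⟨c.left x, ?_⟩⟩
    have := congrFun (congrArg left hc) x
    rwa [conj_left_of_right_eq_one _ _ rfl] at this
  · rintro ⟨d, h⟩
    choose u hu using fun x => isConj_iff.1 (h x)
    refine isConj_iff.2 ⟨⟨u, d⟩, ?_⟩
    ext x
    · rw [conj_left_of_right_eq_one _ _ rfl]
      exact hu x
    · simp

/-- In a regular wreath product with a cyclic top group, the coordinates of a power of `w` that
lies in the base group are conjugate, provided `w` maps to a generator. -/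
theorem isConj_pow_left (w : G ≀ᵣ Q) (hgen : ∀ x : Q, ∃ j : ℕ, w.right ^ j = x) {n : ℕ}
    (hn : w.right ^ n = 1) (x : Q) : IsConj ((w ^ n).left 1) ((w ^ n).left x) := by
  obtain ⟨j, rfl⟩ := hgen x
  refine isConj_iff.2 ⟨(w ^ j).left (w.right ^ j), ?_⟩
  have h := conj_left_of_right_eq_one (w ^ j) (w ^ n) (by rw [pow_right, hn]) (w.right ^ j)
  rw [pow_right, inv_mul_cancel] at h
  rw [← h, ← pow_add, add_comm, pow_add, mul_inv_cancel_right]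

/-! ### Normal form of elements over a generator of the top group -/

section Twist

variable [DecidableEq Q]

/-- The factors of the power are read at the coordinates `(c ^ i)⁻¹` with `i ≤ n`, and below
`orderOf c` only `i = 0` meets the support. -/
theorem mulSingle_pow_left (g : G) {c : Q} {n : ℕ} (hn : n < orderOf c) :
    ((⟨Pi.mulSingle 1 g, c⟩ : G ≀ᵣ Q) ^ (n + 1)).left 1 = g := by
  induction n with
  | zero => simp
  | succ n ih =>
    rw [pow_succ_left, ih (by omega), mul_one]
    have : (c ^ (n + 1))⁻¹ ≠ 1 := by
      rw [Ne, inv_eq_one]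
      exact pow_ne_one_of_lt_orderOf (by omega) hn
    change g * (Pi.mulSingle 1 g : Q → G) ((c ^ (n + 1))⁻¹) = g
    rw [Pi.mulSingle_eq_of_ne this, mul_one]

theorem mulSingle_pow_orderOf_left (g : G) {c : Q} (hc : 0 < orderOf c) :
    ((⟨Pi.mulSingle 1 g, c⟩ : G ≀ᵣ Q) ^ orderOf c).left 1 = g := by
  obtain ⟨n, hn⟩ := Nat.exists_eq_succ_of_ne_zero hc.ne'
  rw [hn]
  exact mulSingle_pow_left g (by omega)

/-- The power of exponent `orderOf c` lies in the base group and all its coordinates are conjugate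
to `g`, so it recovers the class of `g`. Conversely, a constant function conjugates one element to
the other. -/
theorem isConj_mulSingle_iff {g h : G} {c : Q} (hc : 0 < orderOf c)
    (hgen : ∀ x : Q, ∃ j : ℕ, c ^ j = x) :
    IsConj (⟨Pi.mulSingle 1 g, c⟩ : G ≀ᵣ Q) ⟨Pi.mulSingle 1 h, c⟩ ↔ IsConj g h := by
  constructor
  · intro H
    have H' := H.pow (orderOf c)
    have e : ∀ k : G, (⟨Pi.mulSingle 1 k, c⟩ : G ≀ᵣ Q) ^ orderOf c =
        ⟨((⟨Pi.mulSingle 1 k, c⟩ : G ≀ᵣ Q) ^ orderOf c).left, 1⟩ := fun k => by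
      ext x
      · rfl
      · rw [pow_right]; exact pow_orderOf_eq_one c
    rw [e g, e h, isConj_mk_one_iff] at H'
    obtain ⟨d, hd⟩ := H'
    have h1 := hd 1
    rw [mulSingle_pow_orderOf_left h hc] at h1
    have h2 := isConj_pow_left (⟨Pi.mulSingle 1 g, c⟩ : G ≀ᵣ Q) hgen (pow_orderOf_eq_one c)
      (d⁻¹ * 1)
    rw [mulSingle_pow_orderOf_left g hc] at h2
    exact h2.trans h1
  · intro H
    obtain ⟨k, rfl⟩ := isConj_iff.1 H
    refine isConj_iff.2 ⟨⟨fun _ => k, 1⟩, ?_⟩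
    ext x
    · by_cases hx : x = 1
      · subst hx; simp
      · simp [Pi.mulSingle_eq_of_ne hx]
    · simp

theorem exists_isConj_mulSingle (w : G ≀ᵣ Q) (hw : 0 < orderOf w.right)
    (hgen : ∀ x : Q, ∃ j : ℕ, w.right ^ j = x) :
    ∃ g : G, IsConj w ⟨Pi.mulSingle 1 g, w.right⟩ := by
  set c := w.right with hc
  have hex : ∀ x : Q, ∃ j < orderOf c, c ^ j = c⁻¹ * x⁻¹ := fun x => by
    obtain ⟨j, hj⟩ := hgen (c⁻¹ * x⁻¹)
    exact ⟨j % orderOf c, Nat.mod_lt _ hw, by rw [pow_mod_orderOf, hj]⟩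
  choose j hjlt hj using hex
  -- Off the identity coordinate, `j` grows by one along the cycle of `c`.
  have hstep : ∀ x : Q, x ≠ 1 → j (c⁻¹ * x) = j x + 1 := fun x hx => by
    have hlt : j x + 1 < orderOf c := by
      rcases Nat.lt_or_ge (j x + 1) (orderOf c) with h | h
      · exact h
      · have h1 : j x + 1 = orderOf c := le_antisymm (hjlt x) h
        have h2 : c ^ (j x + 1) = x⁻¹ := by rw [pow_succ, hj]; simp [mul_comm]
        rw [h1, pow_orderOf_eq_one] at h2
        exact absurd (inv_eq_one.1 h2.symm) hx
    refine pow_injOn_Iio_orderOf (hjlt _) hlt ?_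
    change c ^ j (c⁻¹ * x) = c ^ (j x + 1)
    rw [pow_succ, hj, hj]
    simp [mul_comm]
  -- Partial products of `w` along the cycle of `c`: they satisfy `u (c⁻¹ * x) = u x * w.left x` for
  -- `x ≠ 1`, so conjugation by `u` clears every coordinate except the one at 1.
  let u : Q → G := fun x => (w ^ j x).left c⁻¹
  refine ⟨u 1 * w.left 1 * (u c⁻¹)⁻¹, isConj_iff.2 ⟨⟨u, 1⟩, ?_⟩⟩
  ext x
  · have e : ((⟨u, 1⟩ : G ≀ᵣ Q) * w * (⟨u, 1⟩ : G ≀ᵣ Q)⁻¹).left x =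
        u x * w.left x * (u (c⁻¹ * x))⁻¹ := by simp [hc]
    rw [e]
    by_cases hx : x = 1
    · subst hx; simp
    · change _ = (Pi.mulSingle 1 (u 1 * w.left 1 * (u c⁻¹)⁻¹) : Q → G) x
      rw [Pi.mulSingle_eq_of_ne hx, mul_inv_eq_one]
      change _ = (w ^ j (c⁻¹ * x)).left c⁻¹
      rw [hstep x hx, pow_succ_left, ← hc, hj x]
      simp [u]
  · simp [hc]

end Twist

end RegularWreathProduct

/-- The conjugacy classes of a finite group form a finite type. -/
noncomputable abbrev conjClassesFintype (G : Type*) [Group G] [Finite G] : Fintype (ConjClasses G) :=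
  Fintype.ofFinite _

attribute [local instance] conjClassesFintype

/-! ### Enumeration of the conjugacy classes -/

namespace RegularWreathProduct

variable {G Q : Type*} [Group G] [CommGroup Q]

/-- The class of an element of the base group whose coordinates lie in prescribed classes. -/
noncomputable def baseClass (t : Q → ConjClasses G) : ConjClasses (G ≀ᵣ Q) :=
  ConjClasses.mk ⟨fun x => (t x).out, 1⟩

open Classical in
/-- The class of an element over `c` with one nontrivial coordinate, in a prescribed class. -/
noncomputable def twistClass (c : Q) (D : ConjClasses G) : ConjClasses (G ≀ᵣ Q) :=
  ConjClasses.mk ⟨Pi.mulSingle 1 D.out, c⟩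

/-- The image of a conjugacy class in the (commutative) top group. -/
def rightClass (C : ConjClasses (G ≀ᵣ Q)) : Q :=
  Quotient.liftOn C right fun _ _ h => right_eq_of_isConj h

@[simp]
theorem rightClass_baseClass (t : Q → ConjClasses G) : rightClass (baseClass t) = 1 := rfl

@[simp]
theorem rightClass_twistClass (c : Q) (D : ConjClasses G) :
    rightClass (twistClass c D) = c := rfl

theorem mk_out (D : ConjClasses G) : ConjClasses.mk D.out = D := Quotient.out_eq D

theorem isConj_out_iff {D E : ConjClasses G} : IsConj D.out E.out ↔ D = E := by
  rw [← ConjClasses.mk_eq_mk_iff_isConj, mk_out, mk_out]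

theorem baseClass_eq_iff {t t' : Q → ConjClasses G} :
    baseClass t = baseClass t' ↔ ∃ d : Q, ∀ x, t (d⁻¹ * x) = t' x := by
  rw [baseClass, baseClass, ConjClasses.mk_eq_mk_iff_isConj, isConj_mk_one_iff]
  simp only [isConj_out_iff]

theorem exists_baseClass_eq {C : ConjClasses (G ≀ᵣ Q)} (hC : rightClass C = 1) :
    ∃ t : Q → ConjClasses G, baseClass t = C := by
  obtain ⟨⟨f, c⟩, rfl⟩ := C.exists_rep
  obtain rfl : c = 1 := hC
  refine ⟨fun x => ConjClasses.mk (f x), ?_⟩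
  rw [baseClass, ConjClasses.mk_eq_mk_iff_isConj, isConj_mk_one_iff]
  refine ⟨1, fun x => ?_⟩
  rw [inv_one, one_mul, ← ConjClasses.mk_eq_mk_iff_isConj, mk_out]

theorem exists_pow_eq_of_card_prime [Finite Q] {p : ℕ} [Fact p.Prime] (hQ : Nat.card Q = p)
    {c : Q} (hc : c ≠ 1) (x : Q) : ∃ j : ℕ, c ^ j = x :=
  mem_powers_iff_mem_zpowers.2 (mem_zpowers_of_prime_card hQ hc)

theorem exists_twistClass_eq [Finite Q] {p : ℕ} [Fact p.Prime] (hQ : Nat.card Q = p)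
    {C : ConjClasses (G ≀ᵣ Q)} (hC : rightClass C ≠ 1) :
    ∃ D : ConjClasses G, twistClass (rightClass C) D = C := by
  classical
  obtain ⟨w, rfl⟩ := C.exists_rep
  obtain ⟨g, hg⟩ := exists_isConj_mulSingle w (orderOf_pos _)
    (exists_pow_eq_of_card_prime hQ hC)
  refine ⟨ConjClasses.mk g, ?_⟩
  change ConjClasses.mk _ = ConjClasses.mk w
  rw [ConjClasses.mk_eq_mk_iff_isConj]
  refine IsConj.trans ?_ hg.symm
  convert (isConj_mulSingle_iff (orderOf_pos _) (exists_pow_eq_of_card_prime hQ hC)).2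
    (ConjClasses.mk_eq_mk_iff_isConj.1 (mk_out (ConjClasses.mk g))) using 1
  rfl

theorem twistClass_injective [Finite Q] {p : ℕ} [Fact p.Prime] (hQ : Nat.card Q = p) {c : Q}
    (hc : c ≠ 1) : Function.Injective (twistClass (G := G) c) := fun D E h => by
  classical
  rw [twistClass, twistClass, ConjClasses.mk_eq_mk_iff_isConj,
    isConj_mulSingle_iff (orderOf_pos _) (exists_pow_eq_of_card_prime hQ hc)] at h
  exact isConj_out_iff.1 h

/-! ### Sums over classes by orbit counting -/

section Sum

attribute [local instance] arrowAction

variable {p : ℕ} [Fact p.Prime]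

theorem baseClass_eq_iff_mem_orbit {t t' : Q → ConjClasses G} :
    baseClass t' = baseClass t ↔ t' ∈ MulAction.orbit Q t := by
  rw [eq_comm, baseClass_eq_iff, MulAction.mem_orbit_iff]
  exact exists_congr fun d => funext_iff.symm

/-- A group of prime order has no proper nontrivial subgroup, and `Q` is transitive on coordinates,
so only constant functions have a nontrivial stabilizer. -/
theorem card_stabilizer (hQ : Nat.card Q = p) (t : Q → ConjClasses G)
    [Decidable (∃ D, t = fun _ => D)] :
    (Nat.card (MulAction.stabilizer Q t) : ℝ) =
      1 + (p - 1) * (if ∃ D, t = fun _ => D then 1 else 0) := by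
  have : Fact (Nat.card Q).Prime := by rw [hQ]; infer_instance
  have key : MulAction.stabilizer Q t = ⊤ ↔ ∃ D, t = fun _ => D := by
    constructor
    · intro h
      refine ⟨t 1, funext fun x => ?_⟩
      have hx : x ∈ MulAction.stabilizer Q t := by rw [h]; trivial
      have := congrFun (MulAction.mem_stabilizer_iff.1 hx) x
      change t (x⁻¹ * x) = t x at this
      rw [← this, inv_mul_cancel]
    · rintro ⟨D, rfl⟩
      rw [eq_top_iff]
      intro x _
      rfl
  split_ifs with h
  · rw [key.2 h, Subgroup.card_top, hQ]
    ring
  · rw [(Subgroup.eq_bot_or_eq_top_of_prime_card (MulAction.stabilizer Q t)).resolve_right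
      (fun h' => h (key.1 h')), Subgroup.card_bot]
    simp

variable [Finite G] [Fintype Q]

open Classical in
theorem sum_rightClass_ne_one (hQ : Nat.card Q = p) (Φ : ConjClasses (G ≀ᵣ Q) → ℝ) :
    ∑ C with rightClass C ≠ 1, Φ C =
      ∑ c ∈ Finset.univ.erase (1 : Q), ∑ D : ConjClasses G, Φ (twistClass c D) := by
  rw [← Finset.sum_product']
  symm
  refine Finset.sum_bij (fun x _ => twistClass x.1 x.2) ?_ ?_ ?_ ?_
  · rintro ⟨c, D⟩ h
    simpa using h
  · rintro ⟨c, D⟩ h ⟨c', D'⟩ h' e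
    obtain rfl : c = c' := by simpa using congrArg rightClass e
    exact congrArg (Prod.mk c) (twistClass_injective hQ (by simpa using h) e)
  · intro C hC
    have hC' : rightClass C ≠ 1 := by simpa using hC
    obtain ⟨D, hD⟩ := exists_twistClass_eq hQ hC'
    exact ⟨(rightClass C, D), by simpa using hC', hD⟩
  · simp

open Classical in
-- Weight each `t` by the size of its stabilizer: by orbit-stabilizer every class receives total
-- weight `p`, and the weight exceeds 1, by `p - 1`, exactly at the constant functions.
theorem sum_rightClass_eq_one (hQ : Nat.card Q = p) (Φ : ConjClasses (G ≀ᵣ Q) → ℝ) :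
    (p : ℝ) * ∑ C with rightClass C = 1, Φ C =
      ∑ t : Q → ConjClasses G, Φ (baseClass t) +
        (p - 1) * ∑ D : ConjClasses G, Φ (baseClass fun _ => D) := by
  have h1 : ∑ t : Q → ConjClasses G, (Nat.card (MulAction.stabilizer Q t) : ℝ) * Φ (baseClass t) =
      (p : ℝ) * ∑ C with rightClass C = 1, Φ C := by
    rw [← Finset.sum_fiberwise_of_maps_to (t := Finset.univ.filter (rightClass · = 1))
      (g := baseClass) (by simp), Finset.mul_sum]
    refine Finset.sum_congr rfl fun C hC => ?_
    obtain ⟨t, rfl⟩ := exists_baseClass_eq (by simpa using hC)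
    have h2 : ∀ t' ∈ Finset.univ.filter (fun t' => baseClass t' = baseClass t),
        (Nat.card (MulAction.stabilizer Q t') : ℝ) * Φ (baseClass t') =
          (Nat.card (MulAction.stabilizer Q t) : ℝ) * Φ (baseClass t) := fun t' ht' => by
      have h3 : baseClass t' = baseClass t := by simpa using ht'
      obtain ⟨d, rfl⟩ := baseClass_eq_iff_mem_orbit.1 h3
      rw [show baseClass (d • t) = baseClass t from h3,
        MulAction.stabilizer_smul_eq_stabilizer_map_conj]
      congr 2
      exact Subgroup.card_map_of_injective (MulAut.conj d).injective
    rw [Finset.sum_congr rfl h2, Finset.sum_const, nsmul_eq_mul, ← mul_assoc]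
    congr 1
    have h4 : (Finset.univ.filter (fun t' => baseClass t' = baseClass t)).card =
        Nat.card (MulAction.orbit Q t) := by
      rw [Nat.card_eq_fintype_card, ← Set.toFinset_card]
      congr 1
      ext t'
      simp [baseClass_eq_iff_mem_orbit]
    rw [h4, ← Nat.cast_mul]
    congr 1
    rw [← hQ, Nat.card_eq_fintype_card, Nat.card_eq_fintype_card, Nat.card_eq_fintype_card]
    exact MulAction.card_orbit_mul_card_stabilizer_eq_card_group Q t
  rw [← h1]
  have h5 : ∑ D : ConjClasses G, Φ (baseClass (Q := Q) fun _ => D) =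
      ∑ t : Q → ConjClasses G, if ∃ D, t = fun _ => D then Φ (baseClass t) else 0 := by
    rw [← Finset.sum_filter]
    refine Finset.sum_bij (fun D _ => fun _ => D) ?_ ?_ ?_ ?_
    · intro D _
      simp only [Finset.mem_filter, Finset.mem_univ, true_and]
      exact ⟨D, rfl⟩
    · intro D _ E _ h
      exact congrFun h 1
    · intro t ht
      obtain ⟨D, rfl⟩ := (Finset.mem_filter.1 ht).2
      exact ⟨D, Finset.mem_univ _, rfl⟩
    · simp
  rw [h5, Finset.mul_sum, ← Finset.sum_add_distrib]
  refine Finset.sum_congr rfl fun t _ => ?_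
  rw [card_stabilizer hQ]
  split_ifs <;> ring

open Classical in
/-- The sum of a function over the conjugacy classes of the wreath product of `G` with a group of
prime order `p`. -/
theorem card_mul_sum_conjClasses (hQ : Nat.card Q = p) (Φ : ConjClasses (G ≀ᵣ Q) → ℝ) :
    (p : ℝ) * ∑ C, Φ C =
      ∑ t : Q → ConjClasses G, Φ (baseClass t) +
        (p - 1) * ∑ D : ConjClasses G, Φ (baseClass fun _ => D) +
        p * ∑ c ∈ Finset.univ.erase (1 : Q), ∑ D : ConjClasses G, Φ (twistClass c D) := by
  rw [← sum_rightClass_eq_one hQ, ← sum_rightClass_ne_one hQ, ← mul_add,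
    Finset.sum_filter_add_sum_filter_not]

end Sum

end RegularWreathProduct

/-! ### Orders of base and twisted classes -/

theorem classOrder_eq_orderOf_out {G : Type*} [Group G] (D : ConjClasses G) :
    classOrder D = orderOf D.out := by
  conv_lhs => rw [← RegularWreathProduct.mk_out D]
  rfl

theorem exists_classOrder_eq_pow {G : Type*} [Group G] {p : ℕ} [Fact p.Prime]
    (hG : IsPGroup p G) (D : ConjClasses G) : ∃ k : ℕ, classOrder D = p ^ k := by
  rw [classOrder_eq_orderOf_out]
  exact (IsPGroup.iff_orderOf.1 hG) D.out

namespace RegularWreathProduct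

variable {G Q : Type*} [Group G] [CommGroup Q] {p : ℕ} [Fact p.Prime]

theorem orderOf_mk_one_dvd_iff (f : Q → G) (n : ℕ) :
    orderOf (⟨f, 1⟩ : G ≀ᵣ Q) ∣ n ↔ ∀ x, orderOf (f x) ∣ n := by
  simp only [orderOf_dvd_iff_pow_eq_one, mk_one_pow, RegularWreathProduct.ext_iff, one_left,
    one_right, and_true, funext_iff, Pi.pow_apply, Pi.one_apply]

theorem exists_orderOf_mk_one_eq [Finite Q] (hG : IsPGroup p G) (f : Q → G) :
    ∃ x, orderOf (⟨f, 1⟩ : G ≀ᵣ Q) = orderOf (f x) := by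
  choose k hk using fun x => (IsPGroup.iff_orderOf.1 hG) (f x)
  obtain ⟨x, hx⟩ := Finite.exists_max k
  refine ⟨x, Nat.dvd_antisymm ((orderOf_mk_one_dvd_iff f _).2 fun y => ?_)
    ((orderOf_mk_one_dvd_iff f _).1 dvd_rfl x)⟩
  rw [hk, hk]
  exact pow_dvd_pow p (hx y)

theorem classOrder_dvd_classOrder_baseClass (t : Q → ConjClasses G) (x : Q) :
    classOrder (t x) ∣ classOrder (baseClass t) := by
  rw [classOrder_eq_orderOf_out]
  exact (orderOf_mk_one_dvd_iff (fun x => (t x).out) _).1 dvd_rfl x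

theorem exists_classOrder_baseClass_eq [Finite Q] (hG : IsPGroup p G) (t : Q → ConjClasses G) :
    ∃ x, classOrder (baseClass t) = classOrder (t x) := by
  obtain ⟨x, hx⟩ := exists_orderOf_mk_one_eq hG fun x => (t x).out
  exact ⟨x, by rw [classOrder_eq_orderOf_out (t x)]; exact hx⟩

omit [Fact p.Prime] in
theorem pow_prime_eq_mk (hQ : Nat.card Q = p) (w : G ≀ᵣ Q) : w ^ p = ⟨(w ^ p).left, 1⟩ := by
  ext x
  · rfl
  · rw [pow_right, ← hQ, pow_card_eq_one']

theorem orderOf_eq_prime (hQ : Nat.card Q = p) {c : Q} (hc : c ≠ 1) : orderOf c = p :=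
  orderOf_eq_prime_iff.2 ⟨by rw [← hQ, pow_card_eq_one'], hc⟩

/-- The image in `Q` has order `p`, which gives the factor `p`; the `p`-th power lies in the base
group and has coordinate `D.out` at 1. -/
theorem mul_classOrder_dvd_classOrder_twistClass (hQ : Nat.card Q = p)
    {c : Q} (hc : c ≠ 1) (D : ConjClasses G) :
    p * classOrder D ∣ classOrder (twistClass c D) := by
  classical
  have hp : 0 < p := (Fact.out : p.Prime).pos
  have hcp := orderOf_eq_prime hQ hc
  rw [classOrder_eq_orderOf_out D]
  change _ ∣ orderOf (⟨Pi.mulSingle 1 D.out, c⟩ : G ≀ᵣ Q)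
  set w : G ≀ᵣ Q := ⟨Pi.mulSingle 1 D.out, c⟩ with hw
  have h1 : p ∣ orderOf w := by
    rw [← hcp]
    exact orderOf_map_dvd (rightHom : G ≀ᵣ Q →* Q) w
  have h2 : orderOf w = p * orderOf (w ^ p) := by
    rw [orderOf_pow_of_dvd hp.ne' h1, Nat.mul_div_cancel' h1]
  rw [h2]
  refine mul_dvd_mul_left p ?_
  rw [pow_prime_eq_mk hQ w]
  have h3 := (orderOf_mk_one_dvd_iff (w ^ p).left _).1 dvd_rfl 1
  have h4 : (w ^ p).left 1 = D.out := by
    rw [← hcp]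
    exact mulSingle_pow_orderOf_left _ (by omega)
  rwa [h4] at h3

/-! ### Recursive bounds for sums over classes -/

section Sums

variable [Finite G] [Fintype Q]

theorem card_erase_one [DecidableEq Q] (hQ : Nat.card Q = p) :
    ((Finset.univ.erase (1 : Q)).card : ℝ) = p - 1 := by
  rw [Finset.card_erase_of_mem (Finset.mem_univ _), Finset.card_univ, ← Nat.card_eq_fintype_card,
    hQ, Nat.cast_sub (Fact.out : p.Prime).one_le, Nat.cast_one]

theorem card_conjClasses (hQ : Nat.card Q = p) :
    (p : ℝ) * Nat.card (ConjClasses (G ≀ᵣ Q)) =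
      (Nat.card (ConjClasses G) : ℝ) ^ p + (p ^ 2 - 1) * Nat.card (ConjClasses G) := by
  classical
  have h := card_mul_sum_conjClasses (G := G) hQ fun _ => 1
  simp only [Finset.sum_const, nsmul_eq_mul, mul_one, Finset.card_univ, card_erase_one hQ,
    ← Nat.card_eq_fintype_card, Nat.card_fun, hQ, Nat.cast_pow] at h
  rw [h]
  ring

omit [Finite G] in
theorem classOrder_baseClass_const (hG : IsPGroup p G) (D : ConjClasses G) :
    classOrder (baseClass (Q := Q) fun _ => D) = classOrder D :=
  (exists_classOrder_baseClass_eq hG _).choose_spec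

/-- The count of the classes with order dividing `n`. -/
theorem sum_dvd_le (hQ : Nat.card Q = p) (hG : IsPGroup p G) (n : ℕ) :
    (p : ℝ) * ∑ C : ConjClasses (G ≀ᵣ Q), (if classOrder C ∣ n then (1 : ℝ) else 0) ≤
      (∑ D : ConjClasses G, if classOrder D ∣ n then (1 : ℝ) else 0) ^ p +
        (p ^ 2 - 1) * ∑ D : ConjClasses G, if classOrder D ∣ n then (1 : ℝ) else 0 := by
  classical
  rw [card_mul_sum_conjClasses hQ]
  simp only [classOrder_baseClass_const hG]
  set N := ∑ D : ConjClasses G, if classOrder D ∣ n then (1 : ℝ) else 0 with hN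
  have h1 : ∑ t : Q → ConjClasses G, (if classOrder (baseClass t) ∣ n then (1 : ℝ) else 0) ≤
      N ^ p := by
    have : N ^ p = ∑ t : Q → ConjClasses G,
        ∏ x, if classOrder (t x) ∣ n then (1 : ℝ) else 0 := by
      have h := Finset.prod_univ_sum (fun _ : Q => Finset.univ)
        (fun _ (D : ConjClasses G) => if classOrder D ∣ n then (1 : ℝ) else 0)
      rwa [Fintype.piFinset_univ, Finset.prod_const, Finset.card_univ,
        ← Nat.card_eq_fintype_card, hQ] at h
    rw [this]
    refine Finset.sum_le_sum fun t _ => ?_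
    split_ifs with ht
    · rw [Finset.prod_eq_one]
      intro x _
      rw [if_pos ((classOrder_dvd_classOrder_baseClass t x).trans ht)]
    · exact Finset.prod_nonneg fun x _ => by split_ifs <;> norm_num
  -- The factor `p` gained by twisting is discarded, so that the bound takes the same form as the
  -- recursion for the class number.
  have h2 : ∑ c ∈ Finset.univ.erase (1 : Q), ∑ D : ConjClasses G,
      (if classOrder (twistClass c D) ∣ n then (1 : ℝ) else 0) ≤ (p - 1) * N := by
    rw [← card_erase_one hQ, ← nsmul_eq_mul]
    refine Finset.sum_le_card_nsmul _ _ _ fun c hc => Finset.sum_le_sum fun D _ => ?_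
    have hd := (Dvd.intro_left p rfl).trans
      (mul_classOrder_dvd_classOrder_twistClass hQ (Finset.ne_of_mem_erase hc) D)
    split_ifs with h3 h4 h4
    · exact le_rfl
    · exact absurd (hd.trans h3) h4
    · exact zero_le_one
    · exact le_rfl
  have hp : (0 : ℝ) ≤ p := Nat.cast_nonneg p
  nlinarith [mul_le_mul_of_nonneg_left h2 hp]

/-- A bound for the sum of a function of the order. -/
theorem sum_classOrder_le (hQ : Nat.card Q = p) (hG : IsPGroup p G) {F : ℕ → ℝ}
    (hF : ∀ n, 0 ≤ F n) {B : ℝ} (hB : ∀ C : ConjClasses (G ≀ᵣ Q), F (classOrder C) ≤ B) :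
    (p : ℝ) * ∑ C : ConjClasses (G ≀ᵣ Q), F (classOrder C) ≤
      (p * (Nat.card (ConjClasses G) : ℝ) ^ (p - 1) + (p - 1)) *
        (∑ D : ConjClasses G, F (classOrder D)) +
      p * (p - 1) * Nat.card (ConjClasses G) * B := by
  classical
  rw [card_mul_sum_conjClasses hQ]
  simp only [classOrder_baseClass_const hG]
  set S := ∑ D : ConjClasses G, F (classOrder D) with hS
  set a := (Nat.card (ConjClasses G) : ℝ) with ha
  have h0 : ∀ x : Q, ∑ t : Q → ConjClasses G, F (classOrder (t x)) = a ^ (p - 1) * S := by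
    intro x
    have e : ∀ t : Q → ConjClasses G, F (classOrder (t x)) =
        ∏ y, if y = x then F (classOrder (t y)) else 1 := by simp
    simp only [e]
    have h := Finset.prod_univ_sum (fun _ : Q => Finset.univ)
      (fun y (D : ConjClasses G) => if y = x then F (classOrder D) else 1)
    rw [Fintype.piFinset_univ] at h
    rw [← h, ← Finset.prod_erase_mul _ _ (Finset.mem_univ x)]
    congr 1
    · rw [Finset.prod_congr rfl (g := fun _ => a)]
      · rw [Finset.prod_const, Finset.card_erase_of_mem (Finset.mem_univ _), Finset.card_univ,
          ← Nat.card_eq_fintype_card, hQ]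
      · intro y hy
        simp [Finset.ne_of_mem_erase hy, ha]
    · simp [hS]
  -- Union bound: the order of a base class is attained at some coordinate, and `F` is nonnegative.
  have h1 : ∑ t : Q → ConjClasses G, F (classOrder (baseClass t)) ≤ p * (a ^ (p - 1) * S) := by
    calc ∑ t : Q → ConjClasses G, F (classOrder (baseClass t))
        ≤ ∑ t : Q → ConjClasses G, ∑ x : Q, F (classOrder (t x)) := by
          refine Finset.sum_le_sum fun t _ => ?_
          obtain ⟨x, hx⟩ := exists_classOrder_baseClass_eq hG t
          rw [hx]
          exact Finset.single_le_sum (f := fun x => F (classOrder (t x)))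
            (fun y _ => hF _) (Finset.mem_univ x)
      _ = p * (a ^ (p - 1) * S) := by
          rw [Finset.sum_comm, Finset.sum_congr rfl fun x _ => h0 x, Finset.sum_const,
            Finset.card_univ, ← Nat.card_eq_fintype_card, hQ, nsmul_eq_mul]
  have h2 : ∑ c ∈ Finset.univ.erase (1 : Q), ∑ D : ConjClasses G, F (classOrder (twistClass c D)) ≤
      (p - 1) * (a * B) := by
    rw [← card_erase_one hQ, ← nsmul_eq_mul]
    refine Finset.sum_le_card_nsmul _ _ _ fun c _ => ?_
    refine (Finset.sum_le_card_nsmul _ _ B fun D _ => hB _).trans_eq ?_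
    rw [nsmul_eq_mul, Finset.card_univ, ← Nat.card_eq_fintype_card]
  have hp : (0 : ℝ) ≤ p := Nat.cast_nonneg p
  nlinarith [mul_le_mul_of_nonneg_left h2 hp]

end Sums

omit [Fact p.Prime] in
theorem orderOf_dvd_prime_mul (hQ : Nat.card Q = p) {n : ℕ} (hn : ∀ g : G, orderOf g ∣ n)
    (w : G ≀ᵣ Q) : orderOf w ∣ p * n := by
  rw [orderOf_dvd_iff_pow_eq_one, pow_mul, ← orderOf_dvd_iff_pow_eq_one, pow_prime_eq_mk hQ,
    orderOf_mk_one_dvd_iff]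
  exact fun x => hn _

end RegularWreathProduct

/-- The model of the Sylow `p`-subgroup of the symmetric group of degree `p ^ n`. -/
abbrev SylowModel (p n : ℕ) : Type := IteratedWreathProduct (Multiplicative (ZMod p)) n

/-! ### The iterated wreath product and its exponent -/

namespace SylowModel

open RegularWreathProduct

variable (p : ℕ) [hp : Fact p.Prime]

omit hp in
theorem card_top : Nat.card (Multiplicative (ZMod p)) = p := by
  rw [Nat.card_congr Multiplicative.toAdd, Nat.card_zmod]

theorem orderOf_dvd (n : ℕ) (g : SylowModel p n) : orderOf g ∣ p ^ n := by
  induction n with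
  | zero =>
    rw [show g = 1 from Subsingleton.elim (α := PUnit) _ _, orderOf_one]
    exact one_dvd _
  | succ n ih =>
    rw [pow_succ']
    exact orderOf_dvd_prime_mul (card_top p) ih g

theorem classOrder_dvd (n : ℕ) (D : ConjClasses (SylowModel p n)) : classOrder D ∣ p ^ n := by
  rw [classOrder_eq_orderOf_out]
  exact orderOf_dvd p n _

theorem isPGroup (n : ℕ) : IsPGroup p (SylowModel p n) := by
  refine IsPGroup.iff_orderOf.2 fun g => ?_
  obtain ⟨k, -, hk⟩ := (Nat.dvd_prime_pow hp.out).1 (orderOf_dvd p n g)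
  exact ⟨k, hk⟩

theorem exists_classOrder_eq (n : ℕ) : ∃ D : ConjClasses (SylowModel p n), classOrder D = p ^ n := by
  induction n with
  | zero =>
    refine ⟨ConjClasses.mk 1, ?_⟩
    exact orderOf_one
  | succ n ih =>
    obtain ⟨D, hD⟩ := ih
    obtain ⟨c, hc⟩ : ∃ c : Multiplicative (ZMod p), c ≠ 1 := exists_ne 1
    refine ⟨twistClass c D, Nat.dvd_antisymm ?_ ?_⟩
    · exact classOrder_dvd p (n + 1) (twistClass c D)
    · rw [pow_succ', ← hD]
      exact mul_classOrder_dvd_classOrder_twistClass (card_top p) hc D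

end SylowModel

/-! ### Class numbers and the odds of a small order -/

namespace SylowModel

open RegularWreathProduct

variable (p : ℕ) [hp : Fact p.Prime]

omit hp in
/-- The number of conjugacy classes. -/
noncomputable def classNum (n : ℕ) : ℝ := Nat.card (ConjClasses (SylowModel p n))

/-- The number of conjugacy classes of elements of order dividing `p ^ m`. -/
noncomputable def dvdCount (n m : ℕ) : ℝ :=
  ∑ C : ConjClasses (SylowModel p n), if classOrder C ∣ p ^ m then (1 : ℝ) else 0

theorem sum_one (n : ℕ) : ∑ _C : ConjClasses (SylowModel p n), (1 : ℝ) = classNum p n := by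
  rw [classNum, Nat.card_eq_fintype_card]
  simp

theorem two_le_cast : (2 : ℝ) ≤ p := by exact_mod_cast hp.out.two_le

theorem sq_sub_one_nonneg : (0 : ℝ) ≤ (p : ℝ) ^ 2 - 1 := by
  nlinarith [two_le_cast p]

theorem classNum_zero : classNum p 0 = 1 := by
  rw [classNum, Nat.cast_eq_one, Nat.card_eq_one_iff_unique]
  refine ⟨⟨fun C D => ?_⟩, ⟨ConjClasses.mk 1⟩⟩
  obtain ⟨g, rfl⟩ := C.exists_rep
  obtain ⟨h, rfl⟩ := D.exists_rep
  rw [show g = h from Subsingleton.elim (α := PUnit) _ _]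

theorem classNum_succ (n : ℕ) :
    (p : ℝ) * classNum p (n + 1) = classNum p n ^ p + (p ^ 2 - 1) * classNum p n :=
  card_conjClasses (G := SylowModel p n) (card_top p)

theorem dvdCount_succ_le (n m : ℕ) :
    (p : ℝ) * dvdCount p (n + 1) m ≤ dvdCount p n m ^ p + (p ^ 2 - 1) * dvdCount p n m :=
  sum_dvd_le (G := SylowModel p n) (card_top p) (isPGroup p n) _

theorem one_le_dvdCount (n m : ℕ) : 1 ≤ dvdCount p n m := by
  have h : classOrder (ConjClasses.mk (1 : SylowModel p n)) ∣ p ^ m := by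
    change orderOf (1 : SylowModel p n) ∣ _
    rw [orderOf_one]
    exact one_dvd _
  refine le_trans (by rw [if_pos h]) (Finset.single_le_sum
    (f := fun C : ConjClasses (SylowModel p n) => if classOrder C ∣ p ^ m then (1 : ℝ) else 0)
    (fun C _ => ?_) (Finset.mem_univ (ConjClasses.mk 1)))
  split_ifs <;> norm_num

theorem dvdCount_le_classNum (n m : ℕ) : dvdCount p n m ≤ classNum p n := by
  rw [← sum_one]
  refine Finset.sum_le_sum fun C _ => ?_
  split_ifs <;> norm_num

theorem one_le_classNum (n : ℕ) : 1 ≤ classNum p n :=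
  (one_le_dvdCount p n 0).trans (dvdCount_le_classNum p n 0)

/-- A class of full order `p ^ (m + 1)` is missed; this makes the odds at level `m + 1` finite and
starts the iteration. -/
theorem dvdCount_succ_self_le (m : ℕ) : dvdCount p (m + 1) m ≤ classNum p (m + 1) - 1 := by
  obtain ⟨D, hD⟩ := exists_classOrder_eq p (m + 1)
  have hD' : ¬ classOrder D ∣ p ^ m := by
    rw [hD, Nat.pow_dvd_pow_iff_le_right hp.out.one_lt]
    omega
  rw [le_sub_comm, ← sum_one, dvdCount, ← Finset.sum_sub_distrib]
  refine le_trans (by rw [if_neg hD']; norm_num) (Finset.single_le_sum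
    (f := fun C : ConjClasses (SylowModel p (m + 1)) =>
      1 - if classOrder C ∣ p ^ m then (1 : ℝ) else 0)
    (fun C _ => ?_) (Finset.mem_univ D))
  split_ifs <;> norm_num

theorem mul_classNum_le (n : ℕ) : (p : ℝ) * classNum p n ≤ (p : ℝ) ^ p ^ n := by
  have h2 := two_le_cast p
  induction n with
  | zero => simp [classNum_zero]
  | succ n ih =>
    have h1 := one_le_classNum p n
    have h3 : classNum p n ≤ classNum p n ^ p := le_self_pow₀ h1 hp.out.ne_zero
    have h4 : (p : ℝ) ^ 2 ≤ (p : ℝ) ^ p := pow_le_pow_right₀ (by linarith) hp.out.two_le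
    calc (p : ℝ) * classNum p (n + 1) = classNum p n ^ p + (p ^ 2 - 1) * classNum p n :=
          classNum_succ p n
      _ ≤ p ^ 2 * classNum p n ^ p := by
          linarith [mul_le_mul_of_nonneg_left h3 (sq_sub_one_nonneg p)]
      _ ≤ p ^ p * classNum p n ^ p := by gcongr
      _ = (p * classNum p n) ^ p := (mul_pow _ _ _).symm
      _ ≤ ((p : ℝ) ^ p ^ n) ^ p := by gcongr
      _ = (p : ℝ) ^ p ^ (n + 1) := by rw [← pow_mul, pow_succ]

theorem classNum_pow_le (n : ℕ) : classNum p n ^ p ≤ p * classNum p (n + 1) := by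
  rw [classNum_succ]
  linarith [mul_nonneg (sq_sub_one_nonneg p) (zero_le_one.trans (one_le_classNum p n))]

/-- The factor `p` absorbs the loss in k_{n+1} ≥ k_n^p / p, because p² ≤ p^p. The induction starts
at level 2, as k_1 = p is too small. -/
theorem mul_two_pow_le_classNum (n : ℕ) : (p : ℝ) * 2 ^ p ^ n ≤ classNum p (n + 2) := by
  have h2 := two_le_cast p
  have hp0 : (0 : ℝ) < p := by linarith
  induction n with
  | zero =>
    have h1 : classNum p 1 = p := by
      have h := classNum_succ p 0
      rw [classNum_zero] at h
      have : (p : ℝ) * classNum p (0 + 1) = p * p := by rw [h]; ring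
      exact mul_left_cancel₀ hp0.ne' this
    have h := classNum_succ p 1
    rw [h1] at h
    have h4 : (p : ℝ) ^ 2 ≤ (p : ℝ) ^ p := pow_le_pow_right₀ (by linarith) hp.out.two_le
    refine le_of_mul_le_mul_left ?_ hp0
    rw [h, pow_zero, pow_one]
    nlinarith [mul_nonneg hp0.le (sub_nonneg.2 h2)]
  | succ n ih =>
    refine le_of_mul_le_mul_left ?_ hp0
    have h4 : (p : ℝ) ^ 2 ≤ (p : ℝ) ^ p := pow_le_pow_right₀ (by linarith) hp.out.two_le
    calc (p : ℝ) * (p * 2 ^ p ^ (n + 1)) = p ^ 2 * (2 ^ p ^ n) ^ p := by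
          rw [← pow_mul, ← pow_succ]; ring
      _ ≤ p ^ p * (2 ^ p ^ n) ^ p := by gcongr
      _ = (p * 2 ^ p ^ n) ^ p := (mul_pow _ _ _).symm
      _ ≤ classNum p (n + 2) ^ p := by gcongr
      _ ≤ p * classNum p (n + 1 + 2) := classNum_pow_le p (n + 2)

/-- One step of the recursion multiplies the odds ratio by at most `(1 + p⁻²)⁻¹`. -/
theorem odds_step {k : ℕ} (hk : 2 ≤ k) {a N a' N' : ℝ} (h1 : 1 ≤ N) (hN : N ≤ a)
    (ha' : k * a' = a ^ k + (k ^ 2 - 1) * a) (hN' : k * N' ≤ N ^ k + (k ^ 2 - 1) * N) :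
    N' * (1 + 1 / (k : ℝ) ^ 2) * (a - N) ≤ N * (a' - N') := by
  obtain ⟨q, rfl⟩ := Nat.exists_eq_add_of_le' hk
  set P : ℝ := ((q + 2 : ℕ) : ℝ) with hP
  have hP0 : 0 < P := by positivity
  set u := N ^ (q + 1) with hu
  have hu1 : 1 ≤ u := one_le_pow₀ h1
  have hN0 : 0 ≤ N := by linarith
  have ha0 : 0 ≤ a := by linarith
  have haq : N ^ q ≤ a ^ q := pow_le_pow_left₀ hN0 hN q
  have hau : u ≤ N * a ^ q := by
    rw [hu, pow_succ']; exact mul_le_mul_of_nonneg_left haq hN0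
  have hau' : N * a ^ q ≤ a ^ (q + 1) := by
    rw [pow_succ']; gcongr
  -- The right side exceeds the left by `N * a * (a ^ q - N ^ q)`.
  have hfac : (a - N) * (a ^ (q + 1) + u) ≤ a ^ (q + 2) - N ^ (q + 2) := by
    have : N * a * N ^ q ≤ N * a * a ^ q := by gcongr
    rw [hu]
    ring_nf at this ⊢
    linarith
  have hX : N ^ (q + 2) = N * u := by rw [hu]; ring
  -- The gain `1 / P ^ 2` is paid for by the extra `a ^ (q + 1) ≥ u`; the value 1 for `u` is the
  -- worst case.
  have hcore : (u + (P ^ 2 - 1)) * (1 + 1 / P ^ 2) ≤ a ^ (q + 1) + u + (P ^ 2 - 1) := by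
    have : (u + (P ^ 2 - 1)) * (1 / P ^ 2) ≤ u := by
      rw [mul_one_div, div_le_iff₀ (by positivity)]
      nlinarith [mul_nonneg (sub_nonneg.2 hu1) (sq_nonneg P), one_le_pow₀ (n := 2)
        (show 1 ≤ P by rw [hP]; push_cast; linarith [Nat.cast_nonneg (α := ℝ) q])]
    linarith
  have h3 : (N * u + (P ^ 2 - 1) * N) * (1 + 1 / P ^ 2) * (a - N) ≤
      N * (a ^ (q + 2) + (P ^ 2 - 1) * a - (N * u + (P ^ 2 - 1) * N)) := by
    rw [hX] at hfac
    have h4 := mul_le_mul_of_nonneg_right hcore (sub_nonneg.2 hN)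
    have h5 : (u + (P ^ 2 - 1)) * (1 + 1 / P ^ 2) * (a - N) ≤
        a ^ (q + 2) + (P ^ 2 - 1) * a - (N * u + (P ^ 2 - 1) * N) := by linarith
    have h6 := mul_le_mul_of_nonneg_left h5 hN0
    linarith
  rw [hX] at hN'
  have hc : 0 ≤ (1 + 1 / P ^ 2) * (a - N) := mul_nonneg (by positivity) (sub_nonneg.2 hN)
  refine le_of_mul_le_mul_left ?_ hP0
  have h7 := mul_le_mul_of_nonneg_right hN' hc
  have h8 := mul_le_mul_of_nonneg_left hN' hN0
  have h9 : N * (P * a') = N * (a ^ (q + 2) + (P ^ 2 - 1) * a) := by rw [ha']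
  linarith

/-- Iterates `odds_step` from level `m + 1`, where the odds are at most the class number. -/
theorem dvdCount_mul_pow_le (m j : ℕ) :
    dvdCount p (m + 1 + j) m * (1 + 1 / (p : ℝ) ^ 2) ^ j ≤
      classNum p (m + 1) * (classNum p (m + 1 + j) - dvdCount p (m + 1 + j) m) := by
  induction j with
  | zero =>
    have h1 := dvdCount_succ_self_le p m
    have h2 := one_le_classNum p (m + 1)
    have h3 := dvdCount_le_classNum p (m + 1) m
    simp only [add_zero, pow_zero, mul_one]
    nlinarith
  | succ j ih =>
    have h1 := one_le_dvdCount p (m + 1 + j) m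
    have h2 := one_le_classNum p (m + 1)
    have hc : 0 < (1 + 1 / (p : ℝ) ^ 2) ^ j := by positivity
    have hD : 0 < classNum p (m + 1 + j) - dvdCount p (m + 1 + j) m := by
      have : 0 < dvdCount p (m + 1 + j) m * (1 + 1 / (p : ℝ) ^ 2) ^ j := mul_pos (by linarith) hc
      exact pos_of_mul_pos_right (this.trans_le ih) (by linarith)
    have hstep := odds_step hp.out.two_le h1 (dvdCount_le_classNum p (m + 1 + j) m)
      (classNum_succ p (m + 1 + j)) (dvdCount_succ_le p (m + 1 + j) m)
    have hD' : 0 ≤ classNum p (m + 1 + j + 1) - dvdCount p (m + 1 + j + 1) m :=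
      sub_nonneg.2 (dvdCount_le_classNum p _ m)
    rw [← add_assoc]
    refine le_of_mul_le_mul_right ?_ hD
    have h3 := mul_le_mul_of_nonneg_right hstep hc.le
    have h4 := mul_le_mul_of_nonneg_right ih hD'
    rw [pow_succ]
    linarith

end SylowModel

/-! ### Moments of the order, of its inverse and of its logarithm -/

namespace SylowModel

open RegularWreathProduct

variable (p : ℕ) [hp : Fact p.Prime]

theorem classOrder_pos (n : ℕ) (C : ConjClasses (SylowModel p n)) : 0 < classOrder C :=
  Nat.pos_of_dvd_of_pos (classOrder_dvd p n C) (pow_pos hp.out.pos n)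

/-- The exponent `p ^ 3` is chosen so that θ^(p^(k+3)) = 2^(p^k), the lower bound for the class
number at level `k + 2`. Thus even the largest order at level `n + 1` is controlled by the class
number at level `n`. -/
theorem pow_pow_le_classNum {θ : ℝ} (h1 : 1 ≤ θ) (hθ : θ ^ p ^ 3 = 2) (n : ℕ) :
    θ ^ p ^ (n + 1) ≤ 2 * classNum p n := by
  have ha := one_le_classNum p n
  rcases lt_or_ge n 2 with hn | hn
  · have : θ ^ p ^ (n + 1) ≤ θ ^ p ^ 3 :=
      pow_le_pow_right₀ h1 (Nat.pow_le_pow_right hp.out.pos (by omega))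
    linarith
  · obtain ⟨k, rfl⟩ := Nat.exists_eq_add_of_le' hn
    have h2 : θ ^ p ^ (k + 2 + 1) = 2 ^ p ^ k := by
      rw [← hθ, ← pow_mul, ← pow_add]
      congr 2
      ring
    have h3 := mul_two_pow_le_classNum p k
    have h4 := mul_le_mul_of_nonneg_right (two_le_cast p) (show (0 : ℝ) ≤ 2 ^ p ^ k by positivity)
    rw [h2]
    linarith [show (0 : ℝ) ≤ 2 ^ p ^ k by positivity]

/-- The union bound over coordinates gives the factor `p`. There are (p - 1) k_n twisted classes,
each contributing at most 2 k_n, against a total of at least k_n^p / p; hence the bounded term. -/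
theorem sum_pow_classOrder_succ_le {θ : ℝ} (h1 : 1 ≤ θ) (hθ : θ ^ p ^ 3 = 2) (n : ℕ) {T : ℝ}
    (hT : 0 ≤ T)
    (h : ∑ C : ConjClasses (SylowModel p n), θ ^ classOrder C ≤ T * classNum p n) :
    ∑ C : ConjClasses (SylowModel p (n + 1)), θ ^ classOrder C ≤
      (p * T + 2 * p ^ 2) * classNum p (n + 1) := by
  have hp2 := two_le_cast p
  have hp0 : (0 : ℝ) < p := by linarith
  have hθ0 : 0 ≤ θ := zero_le_one.trans h1
  have hB : ∀ C : ConjClasses (SylowModel p (n + 1)), θ ^ classOrder C ≤ 2 * classNum p n :=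
    fun C => (pow_le_pow_right₀ h1 (Nat.le_of_dvd (pow_pos hp.out.pos _)
      (classOrder_dvd p (n + 1) C))).trans (pow_pow_le_classNum p h1 hθ n)
  have hrec : (p : ℝ) * ∑ C : ConjClasses (SylowModel p (n + 1)), θ ^ classOrder C ≤
      (p * classNum p n ^ (p - 1) + (p - 1)) *
        (∑ C : ConjClasses (SylowModel p n), θ ^ classOrder C) +
        p * (p - 1) * classNum p n * (2 * classNum p n) :=
    sum_classOrder_le (G := SylowModel p n) (card_top p) (isPGroup p n)
      (F := fun k => θ ^ k) (fun k => pow_nonneg hθ0 k) hB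
  have ha := one_le_classNum p n
  set a := classNum p n with ha_def
  have ha0 : 0 ≤ a := by linarith
  have hpow : a ^ (p - 1) * a = a ^ p := by
    rw [← pow_succ, Nat.sub_add_cancel hp.out.one_le]
  have hsq : a ^ 2 ≤ a ^ p := pow_le_pow_right₀ ha hp.out.two_le
  refine le_of_mul_le_mul_left ?_ hp0
  have hsucc := classNum_succ p n
  rw [← ha_def] at hsucc
  have e : (p : ℝ) * ((p * T + 2 * p ^ 2) * classNum p (n + 1)) =
      (p * T + 2 * p ^ 2) * (a ^ p + (p ^ 2 - 1) * a) := by rw [← hsucc]; ring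
  rw [e]
  have h2 := mul_le_mul_of_nonneg_left h
    (show 0 ≤ p * a ^ (p - 1) + ((p : ℝ) - 1) from add_nonneg (by positivity) (by linarith))
  have h3 : (p * a ^ (p - 1) + ((p : ℝ) - 1)) * (T * a) = p * T * a ^ p + (p - 1) * (T * a) := by
    rw [← hpow]; ring
  have hTa : 0 ≤ T * a := mul_nonneg hT ha0
  have h4 : (p - 1 : ℝ) * (T * a) ≤ p * (p ^ 2 - 1) * (T * a) :=
    mul_le_mul_of_nonneg_right (by nlinarith [sq_nonneg ((p : ℝ) - 1)]) hTa
  have h5 : (p : ℝ) ^ 2 * a ^ 2 ≤ p ^ 2 * a ^ p := by gcongr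
  have h6 : 0 ≤ p * a ^ 2 := by positivity
  have h7 : 0 ≤ (p : ℝ) ^ 2 * ((p ^ 2 - 1) * a) :=
    mul_nonneg (by positivity) (mul_nonneg (sq_sub_one_nonneg p) ha0)
  nlinarith

/-- The coefficient solves T ↦ pT + 2p² up to slack: it starts at 2 ≥ θ, and subtracting 2p² absorbs
the additive term because p ≥ 2. -/
theorem sum_pow_classOrder_le {θ : ℝ} (h1 : 1 ≤ θ) (hθ : θ ^ p ^ 3 = 2) (n : ℕ) :
    ∑ C : ConjClasses (SylowModel p n), θ ^ classOrder C ≤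
      ((2 * p ^ 2 + 2) * p ^ n - 2 * p ^ 2) * classNum p n := by
  have hp2 := two_le_cast p
  induction n with
  | zero =>
    have h2 : θ ≤ 2 := by
      rw [← hθ]; exact le_self_pow₀ h1 (pow_pos hp.out.pos 3).ne'
    have h3 : ∀ C : ConjClasses (SylowModel p 0), classOrder C = 1 := fun C =>
      Nat.dvd_one.1 (classOrder_dvd p 0 C)
    simp only [h3, pow_one, pow_zero]
    rw [← mul_one θ, ← Finset.mul_sum, sum_one, classNum_zero]
    linarith
  | succ n ih =>
    have hpn : (1 : ℝ) ≤ p ^ n := one_le_pow₀ (by linarith)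
    refine (sum_pow_classOrder_succ_le p h1 hθ n ?_ ih).trans ?_
    · nlinarith [sq_nonneg (p : ℝ)]
    · refine mul_le_mul_of_nonneg_right ?_ (zero_le_one.trans (one_le_classNum p _))
      rw [pow_succ (p : ℝ) n]
      nlinarith [mul_nonneg (sq_nonneg (p : ℝ)) (sub_nonneg.2 hp2)]

/-- The mean order of a class grows at most linearly. -/
theorem exists_sum_classOrder_le : ∃ K : ℝ, 0 ≤ K ∧ ∀ n : ℕ, 1 ≤ n →
    ∑ C : ConjClasses (SylowModel p n), (classOrder C : ℝ) ≤ K * n * classNum p n := by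
  have hp2 := two_le_cast p
  have hp0 : (0 : ℝ) < p := by linarith
  set θ : ℝ := (2 : ℝ) ^ (((p ^ 3 : ℕ) : ℝ)⁻¹) with hθ_def
  have hθ : θ ^ p ^ 3 = 2 := Real.rpow_inv_natCast_pow (by norm_num) (pow_pos hp.out.pos 3).ne'
  have h1 : 1 < θ := Real.one_lt_rpow (by norm_num)
    (inv_pos.2 (by exact_mod_cast pow_pos hp.out.pos 3))
  have hlog : 0 < Real.log θ := Real.log_pos h1
  have hθ0 : 0 < θ := by linarith
  have hlp : 0 ≤ Real.log p := Real.log_nonneg (by linarith)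
  refine ⟨(Real.log p + (2 * p ^ 2 + 2)) / Real.log θ, by positivity, fun n hn => ?_⟩
  -- Jensen in tangent-line form: 1 + x ≤ exp x at x = m log θ - n log p.
  have hpt : ∀ m : ℕ, Real.log θ * m ≤ n * Real.log p + θ ^ m / p ^ n := fun m => by
    have h2 := Real.add_one_le_exp (m * Real.log θ - n * Real.log p)
    rw [Real.exp_sub, Real.exp_nat_mul, Real.exp_nat_mul, Real.exp_log hθ0, Real.exp_log hp0] at h2
    linarith
  have hsum := Finset.sum_le_sum fun (C : ConjClasses (SylowModel p n)) (_ : C ∈ Finset.univ) =>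
    hpt (classOrder C)
  rw [← Finset.mul_sum, Finset.sum_add_distrib, ← Finset.sum_div] at hsum
  have hconst : ∑ _C : ConjClasses (SylowModel p n), (n * Real.log p) =
      n * Real.log p * classNum p n := by
    rw [← sum_one, Finset.mul_sum]; simp
  have hpn : (0 : ℝ) < p ^ n := pow_pos hp0 n
  have hdiv : (∑ C : ConjClasses (SylowModel p n), θ ^ classOrder C) / (p : ℝ) ^ n ≤
      (2 * p ^ 2 + 2) * classNum p n := by
    rw [div_le_iff₀ hpn]
    refine (sum_pow_classOrder_le p h1.le hθ n).trans ?_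
    nlinarith [mul_nonneg (sq_nonneg (p : ℝ)) (zero_le_one.trans (one_le_classNum p n))]
  have hn1 : (1 : ℝ) ≤ n := by exact_mod_cast hn
  have ha := one_le_classNum p n
  rw [div_mul_eq_mul_div, div_mul_eq_mul_div, le_div_iff₀ hlog]
  have h8 : (2 * (p : ℝ) ^ 2 + 2) * classNum p n ≤ (2 * p ^ 2 + 2) * n * classNum p n := by
    have : (2 * (p : ℝ) ^ 2 + 2) * 1 ≤ (2 * p ^ 2 + 2) * n := by gcongr
    nlinarith
  linarith

/-- Few classes have order far below `n`. -/
theorem mul_dvdCount_le {R : ℕ} (hR : 2 ≤ R)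
    (hR' : 4 * (p * Real.log p) ≤ Real.log (1 + 1 / (p : ℝ) ^ 2) * R) {n : ℕ} (hn : R ≤ n) :
    n * Real.log (1 + 1 / (p : ℝ) ^ 2) / 4 * dvdCount p n (Nat.log p (n / R)) ≤ classNum p n := by
  have hp2 := two_le_cast p
  have hp0 : (0 : ℝ) < p := by linarith
  set ℓ := Real.log (1 + 1 / (p : ℝ) ^ 2) with hℓ
  set M := Nat.log p (n / R) with hM
  have hc1 : 1 < 1 + 1 / (p : ℝ) ^ 2 := by
    have : 0 < 1 / (p : ℝ) ^ 2 := by positivity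
    linarith
  have hℓ0 : 0 < ℓ := Real.log_pos hc1
  have hlp : 0 ≤ Real.log p := Real.log_nonneg (by linarith)
  have hpM : p ^ M ≤ n / R := Nat.pow_log_le_self p (Nat.div_pos hn (by omega)).ne'
  have hM1 : M + 1 ≤ p ^ M := Nat.lt_pow_self hp.out.one_lt
  have hhalf : n / R ≤ n / 2 := Nat.div_le_div_left hR (by norm_num)
  obtain ⟨j, hj⟩ := Nat.exists_eq_add_of_le (show M + 1 ≤ n by omega)
  -- From M + 1 ≤ p^M ≤ n/R ≤ n/2, at least half of the levels remain for the decay.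
  have hj2 : n ≤ 2 * j := by omega
  have hmain := dvdCount_mul_pow_le p M j
  rw [← hj] at hmain
  have hN := one_le_dvdCount p n M
  have hA := one_le_classNum p (M + 1)
  have hexp : (1 + 1 / (p : ℝ) ^ 2) ^ j = Real.exp (j * ℓ) := by
    rw [Real.exp_nat_mul, hℓ, Real.exp_log (by linarith)]
  have hA2 : classNum p (M + 1) ≤ Real.exp (n * ℓ / 4) := by
    have h1 : classNum p (M + 1) ≤ (p : ℝ) ^ p ^ (M + 1) :=
      le_trans (by nlinarith) (mul_classNum_le p (M + 1))
    have h2 : (p : ℝ) ^ p ^ (M + 1) = Real.exp ((p ^ (M + 1) : ℕ) * Real.log p) := by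
      rw [Real.exp_nat_mul, Real.exp_log hp0]
    refine h1.trans (h2.trans_le (Real.exp_le_exp.2 ?_))
    have h3 : ((p ^ M : ℕ) : ℝ) * R ≤ n := by
      exact_mod_cast (Nat.le_div_iff_mul_le (by omega)).1 hpM
    have hR0 : (0 : ℝ) < R := by exact_mod_cast (by omega : 0 < R)
    have h4 := mul_le_mul_of_nonneg_left hR' (Nat.cast_nonneg (α := ℝ) (p ^ M))
    have h5 := mul_le_mul_of_nonneg_left h3 hℓ0.le
    rw [pow_succ, Nat.cast_mul]
    linarith
  have hx : n * ℓ / 4 ≤ Real.exp (n * ℓ / 4) :=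
    le_trans (by linarith) (Real.add_one_le_exp _)
  have hx0 : 0 ≤ n * ℓ / 4 := by positivity
  -- The decay is at least exp(nℓ/2): half of the exponent pays for the class number, by the choice
  -- of `R`, and the other half yields the factor nℓ/4.
  have hprod : classNum p (M + 1) * (n * ℓ / 4) ≤ (1 + 1 / (p : ℝ) ^ 2) ^ j := by
    rw [hexp]
    calc classNum p (M + 1) * (n * ℓ / 4)
        ≤ Real.exp (n * ℓ / 4) * Real.exp (n * ℓ / 4) := by gcongr
      _ = Real.exp (n * ℓ / 4 + n * ℓ / 4) := (Real.exp_add _ _).symm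
      _ ≤ Real.exp (j * ℓ) := by
          refine Real.exp_le_exp.2 ?_
          have : (n : ℝ) ≤ 2 * j := by exact_mod_cast hj2
          nlinarith
  refine le_of_mul_le_mul_left ?_ (show 0 < classNum p (M + 1) by linarith)
  have h6 := mul_le_mul_of_nonneg_left hprod (show 0 ≤ dvdCount p n M by linarith)
  nlinarith [mul_nonneg (show 0 ≤ classNum p (M + 1) by linarith)
    (show 0 ≤ dvdCount p n M by linarith)]

/-- The mean of the inverse order of a class is at most of order `1 / n`. -/
theorem exists_sum_inv_classOrder_le : ∃ K : ℝ, 0 ≤ K ∧ ∀ n : ℕ, 1 ≤ n →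
    n * ∑ C : ConjClasses (SylowModel p n), ((classOrder C : ℝ))⁻¹ ≤ K * classNum p n := by
  have hp2 := two_le_cast p
  have hp0 : (0 : ℝ) < p := by linarith
  have hℓ0 : 0 < Real.log (1 + 1 / (p : ℝ) ^ 2) := Real.log_pos (by
    have : 0 < 1 / (p : ℝ) ^ 2 := by positivity
    linarith)
  obtain ⟨R₀, hR₀⟩ := exists_nat_ge (4 * (p * Real.log p) / Real.log (1 + 1 / (p : ℝ) ^ 2))
  obtain ⟨R, hR2, hR⟩ : ∃ R : ℕ, 2 ≤ R ∧
      4 * (p * Real.log p) ≤ Real.log (1 + 1 / (p : ℝ) ^ 2) * R := by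
    refine ⟨max 2 R₀, le_max_left _ _, ?_⟩
    rw [div_le_iff₀ hℓ0, mul_comm (R₀ : ℝ)] at hR₀
    refine hR₀.trans (mul_le_mul_of_nonneg_left ?_ hℓ0.le)
    exact_mod_cast le_max_right 2 R₀
  set ℓ := Real.log (1 + 1 / (p : ℝ) ^ 2) with hℓ
  refine ⟨4 / ℓ + R, by positivity, fun n hn => ?_⟩
  have ha := one_le_classNum p n
  have hn0 : (0 : ℝ) ≤ n := Nat.cast_nonneg n
  have h4ℓ : 0 ≤ 4 / ℓ := by positivity
  rcases lt_or_ge n R with hnR | hnR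
  · have h1 : ∑ C : ConjClasses (SylowModel p n), ((classOrder C : ℝ))⁻¹ ≤ classNum p n := by
      rw [← sum_one]
      exact Finset.sum_le_sum fun C _ =>
        inv_le_one_of_one_le₀ (by exact_mod_cast classOrder_pos p n C)
    have h2 : (n : ℝ) ≤ R := by exact_mod_cast hnR.le
    calc n * ∑ C : ConjClasses (SylowModel p n), ((classOrder C : ℝ))⁻¹
        ≤ n * classNum p n := mul_le_mul_of_nonneg_left h1 hn0
      _ ≤ (4 / ℓ + R) * classNum p n :=
          mul_le_mul_of_nonneg_right (by linarith) (by linarith)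
  · have h1 := mul_dvdCount_le p hR2 hR hnR
    rw [← hℓ] at h1
    set M := Nat.log p (n / R) with hM
    have hpM : n ≤ R * p ^ (M + 1) := by
      have := Nat.lt_pow_succ_log_self hp.out.one_lt (n / R)
      rw [Nat.div_lt_iff_lt_mul (by omega), mul_comm] at this
      exact this.le
    have hpM' : (n : ℝ) ≤ R * p ^ (M + 1) := by exact_mod_cast hpM
    -- Orders dividing p^M count for at most 1 each; all others are at least p^(M+1) ≥ n/R.
    have hpt : ∀ C : ConjClasses (SylowModel p n), ((classOrder C : ℝ))⁻¹ ≤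
        (if classOrder C ∣ p ^ M then (1 : ℝ) else 0) + ((p : ℝ) ^ (M + 1))⁻¹ * 1 := by
      intro C
      have hi : 0 ≤ ((p : ℝ) ^ (M + 1))⁻¹ := by positivity
      split_ifs with hC
      · have : ((classOrder C : ℝ))⁻¹ ≤ 1 :=
          inv_le_one_of_one_le₀ (by exact_mod_cast classOrder_pos p n C)
        linarith
      · rw [zero_add, mul_one]
        obtain ⟨k, hk⟩ := exists_classOrder_eq_pow (isPGroup p n) C
        rw [hk, Nat.pow_dvd_pow_iff_le_right hp.out.one_lt, not_le] at hC
        rw [hk, Nat.cast_pow]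
        exact inv_anti₀ (by positivity) (pow_le_pow_right₀ (by linarith) hC)
    have h2 := Finset.sum_le_sum fun (C : ConjClasses (SylowModel p n)) (_ : C ∈ Finset.univ) =>
      hpt C
    rw [Finset.sum_add_distrib, ← Finset.mul_sum, sum_one] at h2
    change _ ≤ dvdCount p n M + _ at h2
    have h3 : n * dvdCount p n M ≤ 4 / ℓ * classNum p n := by
      rw [div_mul_eq_mul_div, le_div_iff₀ hℓ0]
      linarith
    have h4 : n * (((p : ℝ) ^ (M + 1))⁻¹ * classNum p n) ≤ R * classNum p n := by
      rw [← mul_assoc, ← div_eq_mul_inv]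
      refine mul_le_mul_of_nonneg_right ?_ (by linarith)
      rwa [div_le_iff₀ (by positivity)]
    have h5 := mul_le_mul_of_nonneg_left h2 hn0
    linarith

omit hp in
theorem sq_le_exp_add_exp_neg (y : ℝ) : y ^ 2 ≤ 2 * (Real.exp y + Real.exp (-y)) := by
  have h := Real.quadratic_le_exp_of_nonneg (abs_nonneg y)
  rw [sq_abs] at h
  have h1 := Real.exp_abs_le y
  linarith [abs_nonneg y]

/-- The second moment of the logarithm of the order about `log n` is bounded. -/
theorem exists_sum_sq_le : ∃ K : ℝ, 0 ≤ K ∧ ∀ n : ℕ, 1 ≤ n →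
    ∑ C : ConjClasses (SylowModel p n), (Real.log (classOrder C) - Real.log n) ^ 2 ≤
      K * classNum p n := by
  obtain ⟨K₁, hK₁, h₁⟩ := exists_sum_classOrder_le p
  obtain ⟨K₂, hK₂, h₂⟩ := exists_sum_inv_classOrder_le p
  refine ⟨2 * (K₁ + K₂), by positivity, fun n hn => ?_⟩
  have hn0 : (0 : ℝ) < n := by exact_mod_cast hn
  have hpt : ∀ C : ConjClasses (SylowModel p n),
      (Real.log (classOrder C) - Real.log n) ^ 2 ≤
        2 * ((n : ℝ)⁻¹ * classOrder C + n * (classOrder C : ℝ)⁻¹) := by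
    intro C
    have hC : (0 : ℝ) < classOrder C := by exact_mod_cast classOrder_pos p n C
    refine (sq_le_exp_add_exp_neg _).trans_eq ?_
    rw [neg_sub, Real.exp_sub, Real.exp_sub, Real.exp_log hC, Real.exp_log hn0]
    ring
  refine (Finset.sum_le_sum fun C _ => hpt C).trans ?_
  rw [← Finset.mul_sum, Finset.sum_add_distrib, ← Finset.mul_sum, ← Finset.mul_sum, mul_assoc,
    add_mul]
  refine mul_le_mul_of_nonneg_left ?_ zero_le_two
  refine add_le_add ?_ (h₂ n hn)
  rw [inv_mul_le_iff₀ hn0]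
  linarith [h₁ n hn]

end SylowModel

/-! ### Transfer to Sylow subgroups and the uniform measure -/

section Measure

variable {G : Type*} [Group G]

theorem exists_equiv_conjClasses {H : Type*} [Group H] (e : G ≃* H) :
    ∃ f : ConjClasses G ≃ ConjClasses H, ∀ C, classOrder (f C) = classOrder C := by
  have h1 : ∀ C, ConjClasses.map e.symm.toMonoidHom (ConjClasses.map e.toMonoidHom C) = C := by
    intro C
    obtain ⟨g, rfl⟩ := C.exists_rep
    exact congrArg ConjClasses.mk (e.symm_apply_apply g)
  have h2 : ∀ C, ConjClasses.map e.toMonoidHom (ConjClasses.map e.symm.toMonoidHom C) = C := by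
    intro C
    obtain ⟨g, rfl⟩ := C.exists_rep
    exact congrArg ConjClasses.mk (e.apply_symm_apply g)
  refine ⟨⟨_, _, h1, h2⟩, fun C => ?_⟩
  obtain ⟨g, rfl⟩ := C.exists_rep
  exact e.orderOf_eq g

variable [Finite G]

instance : IsProbabilityMeasure (uniformClass G) := by
  unfold uniformClass
  infer_instance

theorem integral_uniformClass (f : ConjClasses G → ℝ) :
    ∫ C, f C ∂(uniformClass G) = (∑ C, f C) / Nat.card (ConjClasses G) := by
  unfold uniformClass
  rw [PMF.integral_eq_sum]
  simp only [PMF.uniformOfFintype_apply, ENNReal.toReal_inv, ENNReal.toReal_natCast, smul_eq_mul]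
  rw [← Finset.mul_sum, Nat.card_eq_fintype_card, div_eq_inv_mul]

end Measure

/-- The second moment about `log_p n` of the logarithm of the order of a random class of a Sylow
subgroup is bounded. -/
theorem exists_integral_sq_sub_log_le (p : ℕ) [hp : Fact p.Prime] : ∃ K : ℝ, 0 ≤ K ∧
    ∀ n : ℕ, 1 ≤ n → ∀ P : Sylow p (Equiv.Perm (Fin (p ^ n))),
      ∫ C, (logOrder p C - Real.log n / Real.log p) ^ 2 ∂(uniformClass P) ≤ K := by
  obtain ⟨K, hK, h⟩ := SylowModel.exists_sum_sq_le p
  refine ⟨K / Real.log p ^ 2, by positivity, fun n hn P => ?_⟩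
  have hlog : 0 < Real.log p := Real.log_pos (by exact_mod_cast hp.out.one_lt)
  obtain ⟨f, hf⟩ := exists_equiv_conjClasses (P.mulEquivIteratedWreathProduct p n
    (Fin (p ^ n)) (by simp) (Multiplicative (ZMod p)) (SylowModel.card_top p))
  have hsum : ∑ C : ConjClasses P, (logOrder p C - Real.log n / Real.log p) ^ 2 =
      (∑ C : ConjClasses (SylowModel p n), (Real.log (classOrder C) - Real.log n) ^ 2) /
        Real.log p ^ 2 := by
    rw [Finset.sum_div, ← f.sum_comp]
    refine Finset.sum_congr rfl fun C _ => ?_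
    rw [hf, logOrder, Real.logb, ← sub_div, div_pow]
  have hcard : (Nat.card (ConjClasses P) : ℝ) = SylowModel.classNum p n :=
    congrArg Nat.cast (Nat.card_congr f)
  rw [integral_uniformClass, hsum, hcard, div_le_iff₀
    (zero_lt_one.trans_le (SylowModel.one_le_classNum p n)), div_mul_eq_mul_div]
  exact div_le_div_of_nonneg_right (h n hn) (by positivity)

theorem theorem3 (p : ℕ) [Fact p.Prime] :
    -- the mean is `log n / log p + O(1)`
    (∃ K : ℝ, ∀ n : ℕ, 1 ≤ n → ∀ P : Sylow p (Equiv.Perm (Fin (p ^ n))),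
      |(∫ C, logOrder p C ∂(uniformClass P)) - Real.log n / Real.log p| ≤ K) ∧
    -- the variance is bounded
    (∃ K : ℝ, ∀ n : ℕ, 1 ≤ n → ∀ P : Sylow p (Equiv.Perm (Fin (p ^ n))),
      variance (logOrder p) (uniformClass P) ≤ K) ∧
    -- almost all classes have order `p ^ ((1 + o(1)) * log_p n)`
    (∀ ε : ℝ, 0 < ε → ∀ δ : ℝ, 0 < δ → ∃ N : ℕ, ∀ n : ℕ, N ≤ n →
      ∀ P : Sylow p (Equiv.Perm (Fin (p ^ n))),
        (uniformClass P).real {C | ε * (Real.log n / Real.log p) <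
          |logOrder p C - Real.log n / Real.log p|} ≤ δ) := by
  obtain ⟨K, hK, h⟩ := exists_integral_sq_sub_log_le p
  refine ⟨⟨(1 + K) / 2, fun n hn P => ?_⟩, ⟨K, fun n hn P => ?_⟩, fun ε hε δ hδ => ?_⟩
  · have h1 : (∫ C, logOrder p C ∂(uniformClass P)) - Real.log n / Real.log p =
        ∫ C, (logOrder p C - Real.log n / Real.log p) ∂(uniformClass P) := by
      rw [integral_sub .of_finite .of_finite]
      simp
    rw [h1]
    calc |∫ C, (logOrder p C - Real.log n / Real.log p) ∂(uniformClass P)|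
        ≤ ∫ C, |logOrder p C - Real.log n / Real.log p| ∂(uniformClass P) :=
          abs_integral_le_integral_abs
      _ ≤ ∫ C, (1 + (logOrder p C - Real.log n / Real.log p) ^ 2) / 2 ∂(uniformClass P) := by
          refine integral_mono .of_finite .of_finite fun C => ?_
          change |logOrder p C - Real.log n / Real.log p| ≤
            (1 + (logOrder p C - Real.log n / Real.log p) ^ 2) / 2
          nlinarith [sq_abs (logOrder p C - Real.log n / Real.log p),
            sq_nonneg (|logOrder p C - Real.log n / Real.log p| - 1)]
      _ = (1 + ∫ C, (logOrder p C - Real.log n / Real.log p) ^ 2 ∂(uniformClass P)) / 2 := by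
          rw [integral_div, integral_add .of_finite .of_finite]
          simp
      _ ≤ (1 + K) / 2 := by linarith [h n hn P]
  · have hm : AEStronglyMeasurable (logOrder p) (uniformClass P) :=
      (Integrable.of_finite (f := logOrder p)).aestronglyMeasurable
    rw [← variance_sub_const hm (Real.log n / Real.log p)]
    exact (variance_le_expectation_sq (Integrable.of_finite).aestronglyMeasurable).trans (h n hn P)
  · have htend : Filter.Tendsto (fun n : ℕ => ε * (Real.log n / Real.log p)) Filter.atTop
        Filter.atTop :=
      ((Real.tendsto_log_atTop.comp tendsto_natCast_atTop_atTop).atTop_div_const (Real.log_pos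
        (by exact_mod_cast (Fact.out : p.Prime).one_lt))).const_mul_atTop hε
    obtain ⟨N, hN⟩ := Filter.eventually_atTop.1
      ((htend.eventually_ge_atTop 1).and (htend.eventually_ge_atTop (K / δ)))
    refine ⟨max N 1, fun n hn P => ?_⟩
    obtain ⟨hs1, hs2⟩ := hN n (le_of_max_le_left hn)
    set L := Real.log n / Real.log p
    have hmarkov := mul_meas_ge_le_integral_of_nonneg (μ := uniformClass P)
      (f := fun C => (logOrder p C - L) ^ 2) (Filter.Eventually.of_forall fun C => sq_nonneg _)
      .of_finite ((ε * L) ^ 2)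
    have hsub : (uniformClass P).real {C | ε * L < |logOrder p C - L|} ≤
        (uniformClass P).real {C | (ε * L) ^ 2 ≤ (logOrder p C - L) ^ 2} := by
      refine measureReal_mono fun C hC => ?_
      have hC' : ε * L < |logOrder p C - L| := hC
      change (ε * L) ^ 2 ≤ (logOrder p C - L) ^ 2
      rw [← sq_abs (logOrder p C - L)]
      exact pow_le_pow_left₀ (by linarith) hC'.le 2
    refine hsub.trans ?_
    have hK2 := hmarkov.trans (h n (le_of_max_le_right hn) P)
    -- Since ε L ≥ 1, its square dominates ε L, which is already at least K/δ.
    have hsq : K / δ ≤ (ε * L) ^ 2 := hs2.trans (by nlinarith)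
    rw [div_le_iff₀ hδ] at hsq
    have hpos : 0 < (ε * L) ^ 2 := by positivity
    exact le_of_mul_le_mul_left (hK2.trans hsq) hpos
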